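/- Fix a dimension $d\ge 2$, a radius $B>0$, a regularization parameter $\lambda>0$ and a privacy level $\epsilon>0$, and let $\Theta_B=\{\theta\in\mathbb R^d:\langle \mathbf 1,\theta\rangle=0,\ \|\theta\|_2\le B\}$. For fixed known differential features $x_1,\dots,x_n\in\mathbb R^d$, in the Bradley–Terry–Luce (BTL) model with parameter $\theta$ the labels $y_1,\dots,y_n\in\{0,1\}$ are independent with $\mathbb P_\theta[y_i=1]=\sigma(x_i^\top\theta)$, where $\sigma(z)=1/(1+e^{-z})$. In the local model the estimator does not see the labels: each $y_i$ is first privatized, independently, by a local randomizer $\mathcal R_i$ (a Markov kernel from $\{0,1\}$ to a measurable space $\mathcal Z$), and an estimator $\hat\theta$ is a measurable, possibly randomized, function of the private views $z_i\sim\mathcal R_i(y_i)$, $i=1,\dots,n$ (it may depend on $x_1,\dots,x_n$). It is $\epsilon$-label DP in the local model if, for every $i$, all $y,y'\in\{0,1\}$ and all measurable $S\subseteq \mathcal Z$, $\mathbb P[\mathcal R_i(y)\in S]\le e^{\epsilon}\,\mathbb P[\mathcal R_i(y')\in S]$. Let $\Sigma_{\mathcal D}=\frac1n\sum_{i=1}^n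 x_ix_i^\top$ and $\|v\|_A=\sqrt{v^\top A v}$. **Theorem (semi-norm lower bound).** There is a universal constant $c>0$ such that for all $d\ge2$ and $B,\lambda,\epsilon>0$ there is an $N$, depending only on $d,B,\lambda,\epsilon$, such that for every $n\ge N$, all $x_1,\dots,x_n\in\mathbb R^d$, and every estimator $\hat\theta$ based on $n$ samples from the BTL model that is $\epsilon$-label DP in the local model, there is a parameter $\theta^*\in\Theta_B$ with $$\mathbb E_{\theta^*}\Big[\|\hat\theta-\theta^*\|_{\Sigma_{\mathcal D}+\lambda I}^2\Big]\ \ge\ c\left(\frac dn+\frac{d}{(e^{\epsilon}-1)^2\,n}\right),$$ where the expectation is over the labels, the local randomizers and the randomness of $\hat\theta$. -/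

import Mathlib

open MeasureTheory ProbabilityTheory
open scoped ENNReal

noncomputable section

/-- The parameter set `Θ_B = {θ ∈ ℝ^d : ⟨1, θ⟩ = 0, ‖θ‖ ≤ B}` (Euclidean norm). -/
def paramSet (d : ℕ) (B : ℝ) : Set (EuclideanSpace ℝ (Fin d)) :=
  {θ | ∑ j, θ j = 0 ∧ ‖θ‖ ≤ B}

/-- The law of one label `y ∈ {0, 1}` (`true` is `1`) in the linear Bradley-Terry-Luce model with
parameter `θ`, for a pair of actions with differential feature `x = φ(s, a¹) - φ(s, a⁰)`:
`P(y = 1) = σ(⟨x, θ⟩) = exp ⟨φ(s, a¹), θ⟩ / (exp ⟨φ(s, a⁰), θ⟩ + exp ⟨φ(s, a¹), θ⟩)`,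
where `σ(z) = 1 / (1 + exp (-z))`. -/
def btlLabelLaw {d : ℕ} (x θ : EuclideanSpace ℝ (Fin d)) : Measure Bool :=
  ENNReal.ofReal (Real.sigmoid (inner ℝ x θ)) • Measure.dirac true +
    ENNReal.ofReal (1 - Real.sigmoid (inner ℝ x θ)) • Measure.dirac false

/-- A local randomizer `R`, which maps a label to a random element of `Z`, is `ε`-label
differentially private. -/
def IsLabelDP {Z : Type*} [MeasurableSpace Z] (ε : ℝ) (R : Kernel Bool Z) : Prop :=
  ∀ (y y' : Bool) (S : Set Z), MeasurableSet S → R y S ≤ ENNReal.ofReal (Real.exp ε) * R y' S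

/-- The law of the private view `(z_1, …, z_n)`: the labels `y_i` are independent, `y_i` follows the
BTL model with differential feature `x i` and parameter `θ`, and each label is privatized
separately, `z_i ∼ R i (y_i)`. -/
def privateViewLaw {d n : ℕ} {Z : Type*} [MeasurableSpace Z]
    (x : Fin n → EuclideanSpace ℝ (Fin d)) (R : Fin n → Kernel Bool Z)
    (θ : EuclideanSpace ℝ (Fin d)) : Measure (Fin n → Z) :=
  Measure.pi fun i => (btlLabelLaw (x i) θ).bind (R i)

/-- The sample covariance matrix `Σ_D = (1/n) ∑ i, x_i x_iᵀ` of the differential features. -/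
def sampleCov {d n : ℕ} (x : Fin n → EuclideanSpace ℝ (Fin d)) : Matrix (Fin d) (Fin d) ℝ :=
  (n : ℝ)⁻¹ • ∑ i, Matrix.vecMulVec (x i).ofLp (x i).ofLp

/-- The matrix-weighted (semi-)norm `‖v‖_A = √(vᵀ A v)`, for a positive semidefinite matrix `A`. -/
def matrixNorm {d : ℕ} (A : Matrix (Fin d) (Fin d) ℝ) (v : EuclideanSpace ℝ (Fin d)) : ℝ :=
  Real.sqrt (v.ofLp ⬝ᵥ A.mulVec v.ofLp)

/-- The risk `E ‖θ̂ - θ‖²_{Σ_D + λ I}` at the parameter `θ` of the estimator `est`, a (possibly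
randomized) function of the private view only; it may be infinite. -/
def semiNormRisk {d n : ℕ} {Z : Type*} [MeasurableSpace Z] (lam : ℝ)
    (x : Fin n → EuclideanSpace ℝ (Fin d)) (R : Fin n → Kernel Bool Z)
    (est : Kernel (Fin n → Z) (EuclideanSpace ℝ (Fin d))) (θ : EuclideanSpace ℝ (Fin d)) : ℝ≥0∞ :=
  ∫⁻ z, ∫⁻ t, ENNReal.ofReal (matrixNorm (sampleCov x + lam • 1) (t - θ) ^ 2) ∂(est z)
    ∂(privateViewLaw x R θ)

end

/-! ### The logistic function -/

/-! This is Assouad's method on a cube adapted to the norm `Σ_D + λI`. Its edge directions `u j` lie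
in the hyperplane `sumZero d` and are orthonormal for that norm, so by Bessel the loss dominates a
sum of one-dimensional squared errors, one per sign of the vertex. Flipping a sign moves the logits
by at most `4δ²n` in total squared distance, whatever the features are.

With `κ = min 1 ((exp ε - 1)²)`, one private view with logit `a` or `b` has Bhattacharyya affinity
at least `1 - κ(a - b)²` (`one_sub_le_integral_sqrt_mul_viewDensity`). Affinities multiply over
independent views, so for `δ² = 1/(16κn)` neighbouring vertices have overlap `∫ min` at least `1/4`
(`half_sub_le_lintegral_min_prod_viewDensity`). `assouad_lower_bound` then gives risk at least
`mδ²/4`, with `m ≥ d - 1` edges. This has the claimed order because `1/κ` is comparable to `1 +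
1/(exp ε - 1)²`. For large `n` the cube fits into the ball, since `λ‖θ‖² ≤ mδ²` at its vertices. -/

theorem sigmoid_sub_sq_le_mul_add (a b : ℝ) :
    (Real.sigmoid a - Real.sigmoid b) ^ 2 ≤ (a - b) ^ 2 * (Real.sigmoid a + Real.sigmoid b) := by
  wlog hab : b ≤ a generalizing a b
  · have := this b a (le_of_not_ge hab)
    nlinarith [this]
  have ha := Real.sigmoid_pos a
  have ha1 := Real.sigmoid_lt_one a
  have hb := Real.sigmoid_pos b
  have hb1 := Real.sigmoid_lt_one b
  have hmono := Real.sigmoid_le hab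
  -- With `1 - exp (-t) ≤ t` this factorization gives a relative Lipschitz bound, hence the weight
  -- `σ(a) + σ(b)` that the mixture estimates need.
  have key : Real.sigmoid a - Real.sigmoid b =
      Real.sigmoid a * (1 - Real.sigmoid b) * (1 - Real.exp (b - a)) := by
    have h1 := Real.exp_pos (-a)
    have h2 := Real.exp_pos (-b)
    have h3 : Real.exp (b - a) = Real.exp (-a) / Real.exp (-b) := by
      rw [← Real.exp_sub]; congr 1; ring
    rw [h3, Real.sigmoid_def, Real.sigmoid_def]
    field_simp
    ring
  have hexp := Real.add_one_le_exp (b - a)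
  have hle : Real.sigmoid a - Real.sigmoid b ≤ Real.sigmoid a * (a - b) := by
    rw [key, mul_assoc]
    gcongr
    have h0 : 1 - Real.exp (b - a) ≤ a - b := by linarith
    have h1 : (0 : ℝ) ≤ 1 - Real.exp (b - a) := by
      have : Real.exp (b - a) ≤ 1 := Real.exp_le_one_iff.2 (by linarith)
      linarith
    nlinarith
  calc (Real.sigmoid a - Real.sigmoid b) ^ 2
      ≤ (Real.sigmoid a * (a - b)) ^ 2 := by gcongr
    _ = (a - b) ^ 2 * (Real.sigmoid a * Real.sigmoid a) := by ring
    _ ≤ (a - b) ^ 2 * (Real.sigmoid a + Real.sigmoid b) := by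
        gcongr
        nlinarith

theorem sigmoid_sub_sq_le_mul_two_sub (a b : ℝ) :
    (Real.sigmoid a - Real.sigmoid b) ^ 2 ≤
      (a - b) ^ 2 * ((1 - Real.sigmoid a) + (1 - Real.sigmoid b)) := by
  have h := sigmoid_sub_sq_le_mul_add (-a) (-b)
  rw [Real.sigmoid_neg, Real.sigmoid_neg] at h
  nlinarith

theorem sigmoid_sub_sq_le (a b : ℝ) :
    (Real.sigmoid a - Real.sigmoid b) ^ 2 ≤ (a - b) ^ 2 := by
  nlinarith [sigmoid_sub_sq_le_mul_add a b, sigmoid_sub_sq_le_mul_two_sub a b]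

/-! ### Pointwise bounds on geometric means -/

theorem sqrt_mul_le_half_add {p q : ℝ} (hp : 0 ≤ p) (hq : 0 ≤ q) :
    √(p * q) ≤ (p + q) / 2 := by
  rw [Real.sqrt_mul hp]
  nlinarith [sq_nonneg (√p - √q), Real.sq_sqrt hp, Real.sq_sqrt hq]

/-- The gap between the two means is `(√p - √q)²/2`, which is at most `(p - q)²/(2(p + q))`. -/
theorem half_add_sub_le_sqrt_mul {p q h : ℝ} (hp : 0 < p) (hq : 0 < q)
    (hpq : (p - q) ^ 2 ≤ 2 * h * (p + q)) : (p + q) / 2 - h ≤ √(p * q) := by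
  have h1 : √(p * q) ≤ (p + q) / 2 := sqrt_mul_le_half_add hp.le hq.le
  have h2 : √(p * q) ^ 2 = p * q := Real.sq_sqrt (by positivity)
  have h3 := Real.sqrt_nonneg (p * q)
  have h4 : 2 * (p * q) ≤ √(p * q) * (p + q) := by nlinarith
  have h5 : ((p + q) / 2 - h) * (p + q) ≤ √(p * q) * (p + q) := by nlinarith
  exact le_of_mul_le_mul_right h5 (by positivity)

/-- AM-GM gives `√(pq) ≤ p + q/4`, and symmetrically. Being linear in `p` and `q` apart from the
root, the bound integrates directly to `∫ min ≥ affinity - 1/2`. -/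
theorem sqrt_mul_sub_le_min {p q : ℝ} (hp : 0 ≤ p) (hq : 0 ≤ q) :
    √(p * q) - (p + q) / 4 ≤ min p q := by
  rw [Real.sqrt_mul hp]
  have h1 := Real.sq_sqrt hp
  have h2 := Real.sq_sqrt hq
  refine le_min ?_ ?_
  · nlinarith [sq_nonneg (√q / 2 - √p), sq_nonneg (√p)]
  · nlinarith [sq_nonneg (√p / 2 - √q), sq_nonneg (√q)]

/-- The privacy-free regime. The difference is `(σ(a) - σ(b))(r - 1)`, and `(r - 1)² ≤ r² + 1`; the
`r²` part is charged to the weight of label 1 and the constant part to that of label 0. -/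
theorem mixture_sub_sq_le {a b r : ℝ} (hr : 0 ≤ r) :
    ((Real.sigmoid a * r + (1 - Real.sigmoid a)) - (Real.sigmoid b * r + (1 - Real.sigmoid b))) ^ 2
      ≤ (a - b) ^ 2 * (r + 1) * ((Real.sigmoid a * r + (1 - Real.sigmoid a)) +
        (Real.sigmoid b * r + (1 - Real.sigmoid b))) := by
  have h1 := sigmoid_sub_sq_le_mul_add a b
  have h2 := sigmoid_sub_sq_le_mul_two_sub a b
  have ha := Real.sigmoid_pos a
  have ha1 := Real.sigmoid_lt_one a
  have hb := Real.sigmoid_pos b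
  have hb1 := Real.sigmoid_lt_one b
  generalize Real.sigmoid a = s at *
  generalize Real.sigmoid b = t at *
  have h3 : (s - t) ^ 2 * r ^ 2 ≤ (a - b) ^ 2 * (s + t) * r ^ 2 := by gcongr
  have hD := sq_nonneg (a - b)
  have h4 : 0 ≤ (a - b) ^ 2 * (r * ((1 - s) + (1 - t))) :=
    mul_nonneg hD (mul_nonneg hr (by linarith))
  have h5 : 0 ≤ (a - b) ^ 2 * (r * (s + t)) := mul_nonneg hD (mul_nonneg hr (by linarith))
  have h6 : 0 ≤ (s - t) ^ 2 * r := by positivity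
  nlinarith

theorem mixture_sub_sq_le_of_mem_Icc {a b r ε : ℝ} (hε : 0 < ε) (h0 : Real.exp (-ε) ≤ r)
    (h1 : r ≤ Real.exp ε) :
    ((Real.sigmoid a * r + (1 - Real.sigmoid a)) - (Real.sigmoid b * r + (1 - Real.sigmoid b))) ^ 2
      ≤ (a - b) ^ 2 * (Real.exp ε - 1) ^ 2 * ((Real.sigmoid a * r + (1 - Real.sigmoid a)) +
        (Real.sigmoid b * r + (1 - Real.sigmoid b))) := by
  have hs := sigmoid_sub_sq_le a b
  have ha := Real.sigmoid_pos a
  have ha1 := Real.sigmoid_lt_one a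
  have hb := Real.sigmoid_pos b
  have hb1 := Real.sigmoid_lt_one b
  generalize Real.sigmoid a = s at *
  generalize Real.sigmoid b = t at *
  have hr : 0 < r := (Real.exp_pos _).trans_le h0
  have hE : 0 < Real.exp ε - 1 := by linarith [Real.add_one_le_exp ε]
  have hEr : 1 ≤ Real.exp ε * r := by
    calc (1 : ℝ) = Real.exp ε * Real.exp (-ε) := by rw [← Real.exp_add]; simp
      _ ≤ _ := by gcongr
  -- Privacy gives `|r - 1| ≤ (exp ε - 1) * min 1 r`, and each mixture is at least `min 1 r`.
  have key : (r - 1) ^ 2 ≤ (Real.exp ε - 1) ^ 2 * ((s * r + (1 - s)) + (t * r + (1 - t))) := by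
    rcases le_total 1 r with h | h
    · calc (r - 1) ^ 2 ≤ (Real.exp ε - 1) ^ 2 * 1 := by
            rw [mul_one]; gcongr
        _ ≤ _ := by gcongr; nlinarith
    · calc (r - 1) ^ 2 = (1 - r) ^ 2 := by ring
        _ ≤ ((Real.exp ε - 1) * r) ^ 2 := by gcongr; nlinarith
        _ = (Real.exp ε - 1) ^ 2 * (r * r) := by ring
        _ ≤ _ := by gcongr; nlinarith
  calc _ = (s - t) ^ 2 * (r - 1) ^ 2 := by ring
    _ ≤ (a - b) ^ 2 * ((Real.exp ε - 1) ^ 2 * ((s * r + (1 - s)) + (t * r + (1 - t)))) := by gcongr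
    _ = _ := by ring

theorem one_sub_sum_le_prod {ι : Type*} (s : Finset ι) (b h : ι → ℝ) (h0 : ∀ i, 0 ≤ b i)
    (h1 : ∀ i, b i ≤ 1) (hb : ∀ i, 1 - h i ≤ b i) : 1 - ∑ i ∈ s, h i ≤ ∏ i ∈ s, b i := by
  classical
  induction s using Finset.induction_on with
  | empty => simp
  | insert a s ha ih =>
    rw [Finset.sum_insert ha, Finset.prod_insert ha]
    have hp1 : ∏ i ∈ s, b i ≤ 1 := Finset.prod_le_one (fun i _ => h0 i) (fun i _ => h1 i)
    nlinarith [hb a, h1 a, mul_nonneg (sub_nonneg.2 (h1 a)) (sub_nonneg.2 hp1)]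

/-! ### Densities of private views -/

theorem IsLabelDP.exists_density {Z : Type*} [MeasurableSpace Z] {ε : ℝ} {R : Kernel Bool Z}
    [IsMarkovKernel R] (hR : IsLabelDP ε R) :
    ∃ r : Z → ℝ, Measurable r ∧ (∀ z, 0 ≤ r z) ∧ Integrable r (R false) ∧
      ∫ z, r z ∂(R false) = 1 ∧
      R true = (R false).withDensity (fun z => ENNReal.ofReal (r z)) ∧
      ∀ᵐ z ∂(R false), Real.exp (-ε) ≤ r z ∧ r z ≤ Real.exp ε := by
  have hac : R true ≪ R false := by
    refine Measure.AbsolutelyContinuous.mk fun S hS h0 => ?_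
    have := hR true false S hS
    rw [h0, mul_zero] at this
    exact le_antisymm this zero_le
  set ρ := (R true).rnDeriv (R false) with hρ
  have hρm : Measurable ρ := Measure.measurable_rnDeriv _ _
  have hwd : (R false).withDensity ρ = R true := Measure.withDensity_rnDeriv_eq _ _ hac
  have htop : ∀ᵐ z ∂(R false), ρ z < ∞ := Measure.rnDeriv_lt_top _ _
  have hexp : ENNReal.ofReal (Real.exp (-ε)) * ENNReal.ofReal (Real.exp ε) = 1 := by
    rw [← ENNReal.ofReal_mul (Real.exp_pos _).le, ← Real.exp_add]; simp
  have hup : ρ ≤ᵐ[R false] fun _ => ENNReal.ofReal (Real.exp ε) := by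
    refine ae_le_of_forall_setLIntegral_le_of_sigmaFinite hρm fun S hS _ => ?_
    rw [← withDensity_apply _ hS, hwd, setLIntegral_const]
    exact hR true false S hS
  have hlow : (fun _ => ENNReal.ofReal (Real.exp (-ε))) ≤ᵐ[R false] ρ := by
    refine ae_le_of_forall_setLIntegral_le_of_sigmaFinite measurable_const fun S hS _ => ?_
    rw [← withDensity_apply ρ hS, hwd, setLIntegral_const]
    calc ENNReal.ofReal (Real.exp (-ε)) * R false S
        ≤ ENNReal.ofReal (Real.exp (-ε)) * (ENNReal.ofReal (Real.exp ε) * R true S) := by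
          gcongr; exact hR false true S hS
      _ = R true S := by rw [← mul_assoc, hexp, one_mul]
  refine ⟨fun z => (ρ z).toReal, hρm.ennreal_toReal, fun z => ENNReal.toReal_nonneg,
    Measure.integrable_toReal_rnDeriv, ?_, ?_, ?_⟩
  · rw [hρ, Measure.integral_toReal_rnDeriv hac]; simp
  · rw [← hwd]
    refine withDensity_congr_ae ?_
    filter_upwards [htop] with z hz
    rw [ENNReal.ofReal_toReal hz.ne]
  · filter_upwards [htop, hup, hlow] with z hz h1 h2
    constructor
    · exact (ENNReal.ofReal_le_iff_le_toReal hz.ne).1 h2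
    · exact ENNReal.toReal_le_of_le_ofReal (Real.exp_pos _).le h1

theorem btlLabelLaw_bind {d : ℕ} {Z : Type*} [MeasurableSpace Z] (x θ : EuclideanSpace ℝ (Fin d))
    (R : Kernel Bool Z) {r : Z → ℝ} (hrm : Measurable r) (hr0 : ∀ z, 0 ≤ r z)
    (hr : R true = (R false).withDensity (fun z => ENNReal.ofReal (r z))) :
    (btlLabelLaw x θ).bind R = (R false).withDensity (fun z => ENNReal.ofReal
      (Real.sigmoid (inner ℝ x θ) * r z + (1 - Real.sigmoid (inner ℝ x θ)))) := by
  have h0 := Real.sigmoid_nonneg (inner ℝ x θ)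
  have h1 := Real.sigmoid_le_one (inner ℝ x θ)
  ext S hS
  rw [Measure.bind_apply hS R.measurable.aemeasurable, btlLabelLaw, lintegral_add_measure,
    lintegral_smul_measure, lintegral_smul_measure, lintegral_dirac, lintegral_dirac,
    withDensity_apply _ hS, hr, withDensity_apply _ hS]
  have : ∀ z, ENNReal.ofReal (Real.sigmoid (inner ℝ x θ) * r z + (1 - Real.sigmoid (inner ℝ x θ)))
      = ENNReal.ofReal (Real.sigmoid (inner ℝ x θ)) * ENNReal.ofReal (r z) +
        ENNReal.ofReal (1 - Real.sigmoid (inner ℝ x θ)) := fun z => by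
    rw [ENNReal.ofReal_add (mul_nonneg h0 (hr0 z)) (by linarith), ENNReal.ofReal_mul h0]
  simp_rw [this]
  rw [lintegral_add_right _ measurable_const, lintegral_const_mul _ (by fun_prop),
    setLIntegral_const]
  simp

theorem pi_withDensity_ofReal {ι : Type*} [Fintype ι] {Z : Type*} [MeasurableSpace Z]
    (μ : ι → Measure Z) [∀ i, IsFiniteMeasure (μ i)] (p : ι → Z → ℝ)
    (h0 : ∀ i z, 0 ≤ p i z) (hi : ∀ i, Integrable (p i) (μ i)) :
    Measure.pi (fun i => (μ i).withDensity fun z => ENNReal.ofReal (p i z)) =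
      (Measure.pi μ).withDensity fun z => ENNReal.ofReal (∏ i, p i (z i)) := by
  have : ∀ i, IsFiniteMeasure ((μ i).withDensity fun z => ENNReal.ofReal (p i z)) := fun i =>
    isFiniteMeasure_withDensity_ofReal (hi i).2
  refine Measure.pi_eq fun s hs => ?_
  rw [withDensity_apply _ (MeasurableSet.univ_pi hs), Measure.restrict_pi_pi,
    ← ofReal_integral_eq_lintegral_ofReal
      (Integrable.fintype_prod_dep fun i => (hi i).restrict)
      (Filter.Eventually.of_forall fun z => Finset.prod_nonneg fun i _ => h0 i _),
    integral_fintype_prod_eq_prod,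
    ENNReal.ofReal_prod_of_nonneg fun i _ => integral_nonneg (h0 i)]
  refine Finset.prod_congr rfl fun i _ => ?_
  rw [withDensity_apply _ (hs i), ofReal_integral_eq_lintegral_ofReal (hi i).restrict
    (Filter.Eventually.of_forall (h0 i))]

/-! ### Assouad's method -/

/-- No guess is good for both targets: `(g - δ)² + (g + δ)² ≥ 2δ²`, integrated against the common
part `min f f'`. -/
theorem two_point_lower_bound {Ω E : Type*} [MeasurableSpace Ω] [MeasurableSpace E]
    (μ : Measure Ω) (est : Kernel Ω E) [IsMarkovKernel est] {f f' : Ω → ℝ}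
    (hf : Measurable f) (hf' : Measurable f') {g : E → ℝ} (hg : Measurable g) {δ c : ℝ}
    (hc : ENNReal.ofReal c ≤ ∫⁻ z, ENNReal.ofReal (min (f z) (f' z)) ∂μ) :
    ENNReal.ofReal (2 * δ ^ 2 * c) ≤
      ∫⁻ z, ENNReal.ofReal (f z) * ∫⁻ t, ENNReal.ofReal ((g t - δ) ^ 2) ∂(est z) ∂μ +
      ∫⁻ z, ENNReal.ofReal (f' z) * ∫⁻ t, ENNReal.ofReal ((g t + δ) ^ 2) ∂(est z) ∂μ := by
  have hm : Measurable fun z => ∫⁻ t, ENNReal.ofReal ((g t - δ) ^ 2) ∂(est z) :=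
    Measurable.lintegral_kernel (by fun_prop)
  rw [← lintegral_add_left (by fun_prop), ENNReal.ofReal_mul (by positivity)]
  calc ENNReal.ofReal (2 * δ ^ 2) * ENNReal.ofReal c
      ≤ ENNReal.ofReal (2 * δ ^ 2) * ∫⁻ z, ENNReal.ofReal (min (f z) (f' z)) ∂μ := by gcongr
    _ = ∫⁻ z, ENNReal.ofReal (2 * δ ^ 2) * ENNReal.ofReal (min (f z) (f' z)) ∂μ :=
        (lintegral_const_mul _ (by fun_prop)).symm
    _ ≤ _ := by
        refine lintegral_mono fun z => ?_
        have key : ENNReal.ofReal (2 * δ ^ 2) ≤ ∫⁻ t, ENNReal.ofReal ((g t - δ) ^ 2) ∂(est z) +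
            ∫⁻ t, ENNReal.ofReal ((g t + δ) ^ 2) ∂(est z) := by
          rw [← lintegral_add_left (by fun_prop)]
          calc ENNReal.ofReal (2 * δ ^ 2) = ∫⁻ _, ENNReal.ofReal (2 * δ ^ 2) ∂(est z) := by simp
            _ ≤ _ := by
              refine lintegral_mono fun t => ?_
              rw [← ENNReal.ofReal_add (by positivity) (by positivity)]
              exact ENNReal.ofReal_le_ofReal (by nlinarith [sq_nonneg (g t)])
        calc ENNReal.ofReal (2 * δ ^ 2) * ENNReal.ofReal (min (f z) (f' z))
            ≤ (∫⁻ t, ENNReal.ofReal ((g t - δ) ^ 2) ∂(est z) +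
            ∫⁻ t, ENNReal.ofReal ((g t + δ) ^ 2) ∂(est z)) * ENNReal.ofReal (min (f z) (f' z)) := by
              gcongr
          _ ≤ _ := by
              rw [mul_comm, mul_add]
              gcongr
              · exact min_le_left _ _
              · exact min_le_right _ _

/-- The sign in `{-1, 1}` that a Boolean encodes. -/
def boolSign (b : Bool) : ℝ := if b then 1 else -1

/-- The vertex of the Boolean cube that differs from `τ` exactly in coordinate `j`. -/
def flipAt {m : ℕ} (j : Fin m) (τ : Fin m → Bool) : Fin m → Bool := Function.update τ j (!τ j)

theorem flipAt_involutive {m : ℕ} (j : Fin m) : Function.Involutive (flipAt j) := fun τ => by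
  simp [flipAt]

theorem boolSign_flipAt {m : ℕ} (j : Fin m) (τ : Fin m → Bool) :
    boolSign (flipAt j τ j) = -boolSign (τ j) := by
  cases h : τ j <;> simp [flipAt, boolSign, h]

theorem boolSign_sq (b : Bool) : boolSign b ^ 2 = 1 := by cases b <;> simp [boolSign]

/-- The worst vertex is at least as bad as the average one. For each coordinate, averaging pairs
every vertex with its flip, and the two-point bound applies to each pair. -/
theorem assouad_lower_bound {Ω E : Type*} [MeasurableSpace Ω] [MeasurableSpace E]
    (μ : Measure Ω) (est : Kernel Ω E) [IsMarkovKernel est] {m : ℕ}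
    {f : (Fin m → Bool) → Ω → ℝ} (hf : ∀ τ, Measurable (f τ)) {g : Fin m → E → ℝ}
    (hg : ∀ j, Measurable (g j)) {δ c : ℝ}
    (hc : ∀ τ j, ENNReal.ofReal c ≤ ∫⁻ z, ENNReal.ofReal (min (f τ z) (f (flipAt j τ) z)) ∂μ) :
    ∃ τ, ENNReal.ofReal (m * δ ^ 2 * c) ≤ ∫⁻ z, ENNReal.ofReal (f τ z) *
      ∫⁻ t, ∑ j, ENNReal.ofReal ((g j t - δ * boolSign (τ j)) ^ 2) ∂(est z) ∂μ := by
  let r (j : Fin m) (τ : Fin m → Bool) : ℝ≥0∞ := ∫⁻ z, ENNReal.ofReal (f τ z) *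
      ∫⁻ t, ENNReal.ofReal ((g j t - δ * boolSign (τ j)) ^ 2) ∂(est z) ∂μ
  have hr : ∀ τ, ∫⁻ z, ENNReal.ofReal (f τ z) *
      ∫⁻ t, ∑ j, ENNReal.ofReal ((g j t - δ * boolSign (τ j)) ^ 2) ∂(est z) ∂μ =
      ∑ j, r j τ := fun τ => by
    rw [← lintegral_finsetSum]
    · refine lintegral_congr fun z => ?_
      rw [lintegral_finsetSum _ (by fun_prop), Finset.mul_sum]
    · intro j _
      exact (hf τ).ennreal_ofReal.mul (Measurable.lintegral_kernel (by fun_prop))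
  simp_rw [hr]
  have hpair : ∀ j τ, ENNReal.ofReal (2 * δ ^ 2 * c) ≤ r j τ + r j (flipAt j τ) := fun j τ => by
    have := two_point_lower_bound μ est (hf τ) (hf (flipAt j τ)) (hg j)
      (δ := δ * boolSign (τ j)) (hc τ j)
    rw [mul_pow, boolSign_sq, mul_one] at this
    refine this.trans_eq ?_
    simp only [r, boolSign_flipAt, mul_neg, sub_neg_eq_add]
  have hsum : ∀ j, 2 * ∑ τ, r j τ = ∑ τ, (r j τ + r j (flipAt j τ)) := fun j => by
    rw [Finset.sum_add_distrib, (flipAt_involutive j).bijective.sum_comp (r j), two_mul]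
  by_contra! hlt
  refine (ENNReal.sum_lt_sum_of_nonempty Finset.univ_nonempty fun τ _ => hlt τ).not_ge ?_
  -- Doubling lets each vertex be counted once as itself and once as a flip.
  rw [Finset.sum_comm, ← ENNReal.mul_le_mul_iff_right (a := 2) (by simp) (by simp),
    Finset.mul_sum _ fun j => ∑ τ, r j τ]
  simp_rw [hsum]
  calc 2 * ∑ _τ : Fin m → Bool, ENNReal.ofReal (m * δ ^ 2 * c)
      = ∑ _j : Fin m, ∑ _τ : Fin m → Bool, ENNReal.ofReal (2 * δ ^ 2 * c) := by
        rw [mul_assoc (m : ℝ), mul_assoc (2 : ℝ),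
          ENNReal.ofReal_mul (p := (m : ℝ)) (by positivity),
          ENNReal.ofReal_mul (p := (2 : ℝ)) (by positivity)]
        simp
        ring
    _ ≤ _ := Finset.sum_le_sum fun j _ => Finset.sum_le_sum fun τ _ => hpair j τ

/-! ### Affinity of private views -/

/-- The density, with respect to `R false`, of a private view whose label equals `true` with
probability `σ(a)`, when `R true` has density `r` with respect to `R false`. -/
noncomputable def viewDensity {Z : Type*} (r : Z → ℝ) (a : ℝ) (z : Z) : ℝ :=
  Real.sigmoid a * r z + (1 - Real.sigmoid a)

theorem viewDensity_pos {Z : Type*} {r : Z → ℝ} (hr : ∀ z, 0 ≤ r z) (a : ℝ) (z : Z) :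
    0 < viewDensity r a z :=
  add_pos_of_nonneg_of_pos (mul_nonneg (Real.sigmoid_nonneg a) (hr z))
    (sub_pos.2 (Real.sigmoid_lt_one a))

theorem measurable_viewDensity {Z : Type*} [MeasurableSpace Z] {r : Z → ℝ} (hr : Measurable r)
    (a : ℝ) : Measurable (viewDensity r a) := by
  unfold viewDensity; fun_prop

theorem integrable_viewDensity {Z : Type*} [MeasurableSpace Z] {μ : Measure Z} [IsFiniteMeasure μ]
    {r : Z → ℝ} (hr : Integrable r μ) (a : ℝ) : Integrable (viewDensity r a) μ :=
  (hr.const_mul _).add (integrable_const _)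

theorem integral_viewDensity {Z : Type*} [MeasurableSpace Z] {μ : Measure Z}
    [IsProbabilityMeasure μ] {r : Z → ℝ} (hr : Integrable r μ) (h1 : ∫ z, r z ∂μ = 1) (a : ℝ) :
    ∫ z, viewDensity r a z ∂μ = 1 := by
  unfold viewDensity
  rw [integral_add (hr.const_mul _) (integrable_const _), integral_const_mul, h1]
  simp

theorem integrable_sqrt_mul {Z : Type*} [MeasurableSpace Z] {μ : Measure Z} {p q : Z → ℝ}
    (hp : Integrable p μ) (hq : Integrable q μ) (hp0 : ∀ z, 0 ≤ p z) (hq0 : ∀ z, 0 ≤ q z) :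
    Integrable (fun z => √(p z * q z)) μ := by
  refine Integrable.mono' ((hp.add hq).div_const 2) ?_ (Filter.Eventually.of_forall fun z => ?_)
  · exact Real.continuous_sqrt.comp_aestronglyMeasurable (hp.1.mul hq.1)
  · rw [Real.norm_of_nonneg (Real.sqrt_nonneg _)]
    exact sqrt_mul_le_half_add (hp0 z) (hq0 z)

theorem integral_sqrt_mul_viewDensity_le_one {Z : Type*} [MeasurableSpace Z] {μ : Measure Z}
    [IsProbabilityMeasure μ] {r : Z → ℝ} (hr0 : ∀ z, 0 ≤ r z) (hr : Integrable r μ)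
    (h1 : ∫ z, r z ∂μ = 1) (a b : ℝ) :
    ∫ z, √(viewDensity r a z * viewDensity r b z) ∂μ ≤ 1 := by
  have ia := integrable_viewDensity hr a
  have ib := integrable_viewDensity hr b
  have h0 := fun a z => (viewDensity_pos hr0 a z).le
  calc ∫ z, √(viewDensity r a z * viewDensity r b z) ∂μ
      ≤ ∫ z, (viewDensity r a z + viewDensity r b z) / 2 ∂μ :=
        integral_mono (integrable_sqrt_mul ia ib (h0 a) (h0 b)) ((ia.add ib).div_const 2)
          fun z => sqrt_mul_le_half_add (h0 a z) (h0 b z)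
    _ = 1 := by
        rw [integral_div, integral_add ia ib, integral_viewDensity hr h1,
          integral_viewDensity hr h1]
        norm_num

theorem one_sub_le_integral_sqrt_mul_viewDensity {Z : Type*} [MeasurableSpace Z] {μ : Measure Z}
    [IsProbabilityMeasure μ] {r : Z → ℝ} (hr0 : ∀ z, 0 ≤ r z) (hr : Integrable r μ)
    (h1 : ∫ z, r z ∂μ = 1) {ε : ℝ} (hε : 0 < ε)
    (hb : ∀ᵐ z ∂μ, Real.exp (-ε) ≤ r z ∧ r z ≤ Real.exp ε) (a b : ℝ) :
    1 - min 1 ((Real.exp ε - 1) ^ 2) * (a - b) ^ 2 ≤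
      ∫ z, √(viewDensity r a z * viewDensity r b z) ∂μ := by
  have ia := integrable_viewDensity hr a
  have ib := integrable_viewDensity hr b
  have h0 := fun a z => (viewDensity_pos hr0 a z).le
  have im : Integrable (fun z => (viewDensity r a z + viewDensity r b z) / 2) μ :=
    (ia.add ib).div_const 2
  -- Applied with `h` a multiple of `r + 1` when `exp ε - 1 ≥ 1`, and with a constant `h` otherwise.
  have aux : ∀ h : Z → ℝ, Integrable h μ → (∀ᵐ z ∂μ, (viewDensity r a z - viewDensity r b z) ^ 2 ≤
      2 * h z * (viewDensity r a z + viewDensity r b z)) →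
      1 - ∫ z, h z ∂μ ≤ ∫ z, √(viewDensity r a z * viewDensity r b z) ∂μ := by
    intro h hi hle
    calc 1 - ∫ z, h z ∂μ
        = ∫ z, ((viewDensity r a z + viewDensity r b z) / 2 - h z) ∂μ := by
          rw [integral_sub im hi, integral_div, integral_add ia ib,
            integral_viewDensity hr h1, integral_viewDensity hr h1]
          norm_num
      _ ≤ _ := by
          refine integral_mono_ae (im.sub hi) (integrable_sqrt_mul ia ib (h0 a) (h0 b)) ?_
          filter_upwards [hle] with z hz
          exact half_add_sub_le_sqrt_mul (viewDensity_pos hr0 a z) (viewDensity_pos hr0 b z) hz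
  have hD := sq_nonneg (a - b)
  rcases le_total 1 ((Real.exp ε - 1) ^ 2) with h | h
  · rw [min_eq_left h]
    have := aux (fun z => (a - b) ^ 2 / 2 * (r z + 1)) ((hr.add (integrable_const 1)).const_mul _)
      (Filter.Eventually.of_forall fun z =>
        (mixture_sub_sq_le (a := a) (b := b) (hr0 z)).trans_eq (by simp only [viewDensity]; ring))
    rw [integral_const_mul, integral_add hr (integrable_const 1), h1] at this
    simp only [integral_const, probReal_univ, smul_eq_mul, mul_one] at this
    linarith
  · rw [min_eq_right h]
    have := aux (fun _ => (a - b) ^ 2 * (Real.exp ε - 1) ^ 2 / 2) (integrable_const _) (by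
      filter_upwards [hb] with z hz
      exact (mixture_sub_sq_le_of_mem_Icc (a := a) (b := b) hε hz.1 hz.2).trans_eq
        (by simp only [viewDensity]; ring))
    simp only [integral_const, probReal_univ, smul_eq_mul, one_mul] at this
    nlinarith [mul_nonneg hD (sq_nonneg (Real.exp ε - 1))]

theorem half_sub_le_lintegral_min_prod_viewDensity {n : ℕ} {Z : Type*} [MeasurableSpace Z]
    {μ : Fin n → Measure Z} [∀ i, IsProbabilityMeasure (μ i)] {r : Fin n → Z → ℝ}
    (hr0 : ∀ i z, 0 ≤ r i z) (hr : ∀ i, Integrable (r i) (μ i)) (h1 : ∀ i, ∫ z, r i z ∂(μ i) = 1)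
    {ε : ℝ} (hε : 0 < ε) (hb : ∀ i, ∀ᵐ z ∂(μ i), Real.exp (-ε) ≤ r i z ∧ r i z ≤ Real.exp ε)
    (a b : Fin n → ℝ) :
    ENNReal.ofReal (1 / 2 - min 1 ((Real.exp ε - 1) ^ 2) * ∑ i, (a i - b i) ^ 2) ≤
      ∫⁻ z, ENNReal.ofReal (min (∏ i, viewDensity (r i) (a i) (z i))
        (∏ i, viewDensity (r i) (b i) (z i))) ∂(Measure.pi μ) := by
  set p : (Fin n → Z) → ℝ := fun z => ∏ i, viewDensity (r i) (a i) (z i) with hp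
  set q : (Fin n → Z) → ℝ := fun z => ∏ i, viewDensity (r i) (b i) (z i) with hq
  have h0 := fun i a z => (viewDensity_pos (hr0 i) a z).le
  have hp0 : ∀ z, 0 ≤ p z := fun z => Finset.prod_nonneg fun i _ => h0 i _ _
  have hq0 : ∀ z, 0 ≤ q z := fun z => Finset.prod_nonneg fun i _ => h0 i _ _
  have ip : Integrable p (Measure.pi μ) :=
    Integrable.fintype_prod_dep fun i => integrable_viewDensity (hr i) (a i)
  have iq : Integrable q (Measure.pi μ) :=
    Integrable.fintype_prod_dep fun i => integrable_viewDensity (hr i) (b i)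
  have hpi : ∫ z, p z ∂(Measure.pi μ) = 1 := by
    rw [hp, integral_fintype_prod_eq_prod]
    exact Finset.prod_eq_one fun i _ => integral_viewDensity (hr i) (h1 i) _
  have hqi : ∫ z, q z ∂(Measure.pi μ) = 1 := by
    rw [hq, integral_fintype_prod_eq_prod]
    exact Finset.prod_eq_one fun i _ => integral_viewDensity (hr i) (h1 i) _
  have im : Integrable (fun z => (p z + q z) / 4) (Measure.pi μ) := (ip.add iq).div_const 4
  have iS := integrable_sqrt_mul ip iq hp0 hq0
  have imin : Integrable (fun z => min (p z) (q z)) (Measure.pi μ) := ip.inf iq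
  rw [← ofReal_integral_eq_lintegral_ofReal imin
    (Filter.Eventually.of_forall fun z => le_min (hp0 z) (hq0 z))]
  refine ENNReal.ofReal_le_ofReal ?_
  have hBC : 1 - ∑ i, min 1 ((Real.exp ε - 1) ^ 2) * (a i - b i) ^ 2 ≤
      ∫ z, √(p z * q z) ∂(Measure.pi μ) := by
    have : ∀ z, √(p z * q z) =
        ∏ i, √(viewDensity (r i) (a i) (z i) * viewDensity (r i) (b i) (z i)) := fun z => by
      rw [← Real.sqrt_prod _ fun i _ => mul_nonneg (h0 i _ _) (h0 i _ _), hp, hq,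
        Finset.prod_mul_distrib]
    simp_rw [this]
    rw [integral_fintype_prod_eq_prod
      (f := fun i z => √(viewDensity (r i) (a i) z * viewDensity (r i) (b i) z))]
    exact one_sub_sum_le_prod _ _ _ (fun i => integral_nonneg fun z => Real.sqrt_nonneg _)
      (fun i => integral_sqrt_mul_viewDensity_le_one (hr0 i) (hr i) (h1 i) _ _)
      fun i => one_sub_le_integral_sqrt_mul_viewDensity (hr0 i) (hr i) (h1 i) hε (hb i) _ _
  rw [← Finset.mul_sum] at hBC
  have hmono : ∫ z, (√(p z * q z) - (p z + q z) / 4) ∂(Measure.pi μ) ≤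
      ∫ z, min (p z) (q z) ∂(Measure.pi μ) :=
    integral_mono (iS.sub im) imin fun z => sqrt_mul_sub_le_min (hp0 z) (hq0 z)
  rw [integral_sub iS im, integral_div, integral_add ip iq, hpi, hqi] at hmono
  linarith

/-! ### Geometry of the regularized covariance -/

/-- A linear embedding under which `‖·‖_{Σ_D + λ I}` becomes the Euclidean norm. -/
noncomputable def covEmbedding {d n : ℕ} (lam : ℝ) (x : Fin n → EuclideanSpace ℝ (Fin d)) :
    EuclideanSpace ℝ (Fin d) →ₗ[ℝ] EuclideanSpace ℝ (Fin n ⊕ Fin d) where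
  toFun v := WithLp.toLp 2 (Sum.elim (fun i => (√n)⁻¹ * inner ℝ (x i) v) fun k => √lam * v k)
  map_add' u v := by
    ext k
    cases k <;> simp [inner_add_right, mul_add]
  map_smul' c v := by
    ext k
    cases k <;> simp [inner_smul_right] <;> ring

theorem norm_covEmbedding_sq {d n : ℕ} {lam : ℝ} (hlam : 0 ≤ lam)
    (x : Fin n → EuclideanSpace ℝ (Fin d)) (v : EuclideanSpace ℝ (Fin d)) :
    ‖covEmbedding lam x v‖ ^ 2 = (n : ℝ)⁻¹ * ∑ i, (inner ℝ (x i) v) ^ 2 + lam * ‖v‖ ^ 2 := by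
  rw [EuclideanSpace.real_norm_sq_eq, EuclideanSpace.real_norm_sq_eq, Fintype.sum_sum_type]
  simp [covEmbedding, mul_pow, Finset.mul_sum, Real.sq_sqrt hlam]

theorem matrixNorm_sq {d n : ℕ} {lam : ℝ} (hlam : 0 ≤ lam)
    (x : Fin n → EuclideanSpace ℝ (Fin d)) (v : EuclideanSpace ℝ (Fin d)) :
    matrixNorm (sampleCov x + lam • 1) v ^ 2 = ‖covEmbedding lam x v‖ ^ 2 := by
  have : v.ofLp ⬝ᵥ (sampleCov x + lam • 1).mulVec v.ofLp = ‖covEmbedding lam x v‖ ^ 2 := by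
    rw [norm_covEmbedding_sq hlam, Matrix.add_mulVec, dotProduct_add, sampleCov,
      Matrix.smul_mulVec, Matrix.smul_mulVec, Matrix.one_mulVec, dotProduct_smul, dotProduct_smul,
      Matrix.sum_mulVec, dotProduct_sum, EuclideanSpace.real_norm_sq_eq]
    congr 2
    · refine Finset.sum_congr rfl fun i _ => ?_
      rw [Matrix.vecMulVec_mulVec]
      simp [PiLp.inner_apply, dotProduct, Finset.mul_sum, sq, mul_comm, mul_assoc]
    · simp [dotProduct, sq]
  rw [matrixNorm, this, Real.sqrt_sq (norm_nonneg _)]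

theorem covEmbedding_injective {d n : ℕ} {lam : ℝ} (hlam : 0 < lam)
    (x : Fin n → EuclideanSpace ℝ (Fin d)) : Function.Injective (covEmbedding lam x) := by
  rw [injective_iff_map_eq_zero]
  intro v hv
  have h := norm_covEmbedding_sq hlam.le x v
  rw [hv, norm_zero] at h
  have h1 : 0 ≤ (n : ℝ)⁻¹ * ∑ i, (inner ℝ (x i) v) ^ 2 :=
    mul_nonneg (by positivity) (Finset.sum_nonneg fun i _ => sq_nonneg _)
  have h2 : 0 ≤ lam * ‖v‖ ^ 2 := by positivity
  have h3 : lam * ‖v‖ ^ 2 = 0 := by nlinarith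
  have h4 : ‖v‖ ^ 2 = 0 := (mul_eq_zero.1 h3).resolve_left hlam.ne'
  simpa using h4

/-- The hyperplane of vectors whose coordinates sum to zero. -/
def sumZero (d : ℕ) : Submodule ℝ (EuclideanSpace ℝ (Fin d)) where
  carrier := {v | ∑ j, v j = 0}
  add_mem' {u v} hu hv := by
    simp only [Set.mem_ofPred_eq] at hu hv ⊢
    simp [Finset.sum_add_distrib, hu, hv]
  zero_mem' := by simp
  smul_mem' c v hv := by
    simp only [Set.mem_ofPred_eq] at hv ⊢
    simp [← Finset.mul_sum, hv]

theorem le_finrank_sumZero (d : ℕ) : d ≤ Module.finrank ℝ (sumZero d) + 1 := by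
  let φ : EuclideanSpace ℝ (Fin d) →ₗ[ℝ] ℝ :=
    { toFun := fun v => ∑ j, v j
      map_add' := fun u v => by simp [Finset.sum_add_distrib]
      map_smul' := fun c v => by simp [Finset.mul_sum] }
  have hker : LinearMap.ker φ = sumZero d := by ext v; rfl
  have h := LinearMap.finrank_range_add_finrank_ker φ
  rw [hker, finrank_euclideanSpace, Fintype.card_fin] at h
  have h1 : Module.finrank ℝ (LinearMap.range φ) ≤ 1 := by
    simpa using Submodule.finrank_le (LinearMap.range φ)
  omega

/-- Orthonormalizing inside the image of `sumZero d` keeps the preimages in the hyperplane;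
injectivity keeps its dimension. -/
theorem exists_orthonormal_covEmbedding {d n : ℕ} {lam : ℝ} (hlam : 0 < lam)
    (x : Fin n → EuclideanSpace ℝ (Fin d)) :
    ∃ u : Fin (Module.finrank ℝ (sumZero d)) → EuclideanSpace ℝ (Fin d),
      (∀ j, ∑ k, u j k = 0) ∧ Orthonormal ℝ fun j => covEmbedding lam x (u j) := by
  let W := (sumZero d).map (covEmbedding lam x)
  have hW : Module.finrank ℝ W = Module.finrank ℝ (sumZero d) :=
    (Submodule.equivMapOfInjective _ (covEmbedding_injective hlam x) _).symm.finrank_eq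
  let e : OrthonormalBasis (Fin (Module.finrank ℝ (sumZero d))) ℝ W :=
    (stdOrthonormalBasis ℝ W).reindex (finCongr hW)
  choose u hu hue using fun j => Submodule.mem_map.1 (e j).2
  refine ⟨u, hu, ?_⟩
  simp_rw [hue]
  exact e.orthonormal.comp_linearIsometry W.subtypeₗᵢ

/-! ### The lower bound -/

/-- The vertex of a hypercube of half-width `δ` with edge directions `u j` and signs `τ`. -/
noncomputable def cubeVertex {d m : ℕ} (δ : ℝ) (u : Fin m → EuclideanSpace ℝ (Fin d))
    (τ : Fin m → Bool) : EuclideanSpace ℝ (Fin d) :=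
  ∑ j, (δ * boolSign (τ j)) • u j

theorem cubeVertex_sub_flipAt {d m : ℕ} (δ : ℝ) (u : Fin m → EuclideanSpace ℝ (Fin d))
    (τ : Fin m → Bool) (j : Fin m) :
    cubeVertex δ u τ - cubeVertex δ u (flipAt j τ) = (2 * δ * boolSign (τ j)) • u j := by
  rw [cubeVertex, cubeVertex, ← Finset.sum_sub_distrib, Finset.sum_eq_single j]
  · rw [boolSign_flipAt, ← sub_smul]
    congr 1
    ring
  · intro k _ hk
    rw [flipAt, Function.update_of_ne hk, sub_self]
  · simp

theorem cubeVertex_mem_sumZero {d m : ℕ} (δ : ℝ) {u : Fin m → EuclideanSpace ℝ (Fin d)}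
    (hu : ∀ j, u j ∈ sumZero d) (τ : Fin m → Bool) : cubeVertex δ u τ ∈ sumZero d :=
  Submodule.sum_mem _ fun j _ => Submodule.smul_mem _ _ (hu j)

theorem inner_covEmbedding_cubeVertex {d n m : ℕ} {lam : ℝ} (δ : ℝ)
    {x : Fin n → EuclideanSpace ℝ (Fin d)} {u : Fin m → EuclideanSpace ℝ (Fin d)}
    (hu : Orthonormal ℝ fun j => covEmbedding lam x (u j)) (τ : Fin m → Bool) (j : Fin m) :
    inner ℝ (covEmbedding lam x (u j)) (covEmbedding lam x (cubeVertex δ u τ)) =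
      δ * boolSign (τ j) := by
  rw [cubeVertex, map_sum]
  simp_rw [map_smul]
  exact hu.inner_right_fintype (fun j => δ * boolSign (τ j)) j

theorem norm_covEmbedding_cubeVertex_sq {d n m : ℕ} {lam : ℝ} (δ : ℝ)
    {x : Fin n → EuclideanSpace ℝ (Fin d)} {u : Fin m → EuclideanSpace ℝ (Fin d)}
    (hu : Orthonormal ℝ fun j => covEmbedding lam x (u j)) (τ : Fin m → Bool) :
    ‖covEmbedding lam x (cubeVertex δ u τ)‖ ^ 2 = m * δ ^ 2 := by
  have h : covEmbedding lam x (cubeVertex δ u τ) =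
      ∑ j, (δ * boolSign (τ j)) • covEmbedding lam x (u j) := by
    rw [cubeVertex, map_sum]
    simp_rw [map_smul]
  rw [← real_inner_self_eq_norm_sq]
  nth_rewrite 1 [h]
  rw [sum_inner]
  simp_rw [inner_smul_left, inner_covEmbedding_cubeVertex δ hu]
  simp [← sq, mul_pow, boolSign_sq]

/-- Bessel's inequality; `t` may leave the span of the `u j`. -/
theorem sum_inner_sub_sq_le_matrixNorm_sq {d n m : ℕ} {lam : ℝ} (hlam : 0 ≤ lam) (δ : ℝ)
    {x : Fin n → EuclideanSpace ℝ (Fin d)} {u : Fin m → EuclideanSpace ℝ (Fin d)}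
    (hu : Orthonormal ℝ fun j => covEmbedding lam x (u j)) (τ : Fin m → Bool)
    (t : EuclideanSpace ℝ (Fin d)) :
    ∑ j, (inner ℝ (covEmbedding lam x (u j)) (covEmbedding lam x t) - δ * boolSign (τ j)) ^ 2 ≤
      matrixNorm (sampleCov x + lam • 1) (t - cubeVertex δ u τ) ^ 2 := by
  rw [matrixNorm_sq hlam]
  refine le_trans (le_of_eq ?_)
    (hu.sum_inner_products_le (covEmbedding lam x (t - cubeVertex δ u τ)) (s := Finset.univ))
  refine Finset.sum_congr rfl fun j _ => ?_
  rw [map_sub, inner_sub_right, inner_covEmbedding_cubeVertex δ hu, Real.norm_eq_abs, sq_abs]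

theorem sum_inner_sq_le_of_norm_covEmbedding_eq_one {d n : ℕ} {lam : ℝ} (hlam : 0 ≤ lam)
    (hn : 0 < n) {x : Fin n → EuclideanSpace ℝ (Fin d)} {v : EuclideanSpace ℝ (Fin d)}
    (hv : ‖covEmbedding lam x v‖ = 1) : ∑ i, (inner ℝ (x i) v) ^ 2 ≤ (n : ℝ) := by
  have h := norm_covEmbedding_sq hlam x v
  rw [hv] at h
  have hn' : (0 : ℝ) < n := by exact_mod_cast hn
  have h1 : 0 ≤ lam * ‖v‖ ^ 2 := by positivity
  have h2 : (n : ℝ)⁻¹ * ∑ i, (inner ℝ (x i) v) ^ 2 ≤ 1 := by linarith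
  rwa [inv_mul_le_iff₀ hn', mul_one] at h2

theorem semiNormRisk_eq_lintegral_prod_viewDensity {d n : ℕ} {Z : Type*} [MeasurableSpace Z]
    (lam : ℝ) (x : Fin n → EuclideanSpace ℝ (Fin d)) (R : Fin n → Kernel Bool Z)
    [∀ i, IsMarkovKernel (R i)] (est : Kernel (Fin n → Z) (EuclideanSpace ℝ (Fin d)))
    [IsMarkovKernel est] (θ : EuclideanSpace ℝ (Fin d)) {r : Fin n → Z → ℝ}
    (hrm : ∀ i, Measurable (r i)) (hr0 : ∀ i z, 0 ≤ r i z)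
    (hri : ∀ i, Integrable (r i) (R i false))
    (hr : ∀ i, R i true = (R i false).withDensity fun z => ENNReal.ofReal (r i z)) :
    semiNormRisk lam x R est θ = ∫⁻ z,
      ENNReal.ofReal (∏ i, viewDensity (r i) (inner ℝ (x i) θ) (z i)) *
        ∫⁻ t, ENNReal.ofReal (matrixNorm (sampleCov x + lam • 1) (t - θ) ^ 2) ∂(est z)
      ∂(Measure.pi fun i => R i false) := by
  have hlaw : privateViewLaw x R θ = (Measure.pi fun i => R i false).withDensity
      fun z => ENNReal.ofReal (∏ i, viewDensity (r i) (inner ℝ (x i) θ) (z i)) := by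
    rw [← pi_withDensity_ofReal _ (fun i => viewDensity (r i) (inner ℝ (x i) θ))
      (fun i z => (viewDensity_pos (hr0 i) _ z).le) fun i => integrable_viewDensity (hri i) _]
    unfold privateViewLaw
    congr 1
    funext i
    exact btlLabelLaw_bind (x i) θ (R i) (hrm i) (hr0 i) (hr i)
  have hf : Measurable fun z : Fin n → Z =>
      ∏ i, viewDensity (r i) (inner ℝ (x i) θ) (z i) :=
    Finset.measurable_fun_prod _ fun i _ =>
      (measurable_viewDensity (hrm i) _).comp (measurable_pi_apply i)
  have hM : Measurable fun t =>
      ENNReal.ofReal (matrixNorm (sampleCov x + lam • 1) (t - θ) ^ 2) := by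
    refine Continuous.measurable ?_
    unfold matrixNorm
    refine ENNReal.continuous_ofReal.comp (Continuous.pow (Real.continuous_sqrt.comp ?_) 2)
    have hc : Continuous fun t : EuclideanSpace ℝ (Fin d) => (t - θ).ofLp := by fun_prop
    exact hc.dotProduct (continuous_const.matrix_mulVec hc)
  rw [semiNormRisk, hlaw, lintegral_withDensity_eq_lintegral_mul _ hf.ennreal_ofReal
    hM.lintegral_kernel]
  rfl

theorem exists_le_semiNormRisk_of_orthonormal {d n m : ℕ} {lam ε δ : ℝ} (hlam : 0 < lam)
    (hε : 0 < ε) (hn : 0 < n) (hδ : min 1 ((Real.exp ε - 1) ^ 2) * δ ^ 2 * n ≤ 1 / 16)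
    {Z : Type*} [MeasurableSpace Z] (x : Fin n → EuclideanSpace ℝ (Fin d))
    (R : Fin n → Kernel Bool Z) [∀ i, IsMarkovKernel (R i)]
    (est : Kernel (Fin n → Z) (EuclideanSpace ℝ (Fin d))) [IsMarkovKernel est]
    (hR : ∀ i, IsLabelDP ε (R i)) {u : Fin m → EuclideanSpace ℝ (Fin d)}
    (hu : Orthonormal ℝ fun j => covEmbedding lam x (u j)) :
    ∃ τ, ENNReal.ofReal (m * δ ^ 2 / 4) ≤ semiNormRisk lam x R est (cubeVertex δ u τ) := by
  choose r hrm hr0 hri hr1 hr hrb using fun i => (hR i).exists_density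
  have hf : ∀ τ, Measurable fun z : Fin n → Z =>
      ∏ i, viewDensity (r i) (inner ℝ (x i) (cubeVertex δ u τ)) (z i) := fun τ =>
    Finset.measurable_fun_prod _ fun i _ =>
      (measurable_viewDensity (hrm i) _).comp (measurable_pi_apply i)
  have hg : ∀ j, Measurable fun t : EuclideanSpace ℝ (Fin d) =>
      inner ℝ (covEmbedding lam x (u j)) (covEmbedding lam x t) := fun j =>
    (continuous_const.inner (LinearMap.continuous_of_finiteDimensional _)).measurable
  have hc : ∀ τ j, ENNReal.ofReal (1 / 4) ≤ ∫⁻ z, ENNReal.ofReal (min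
      (∏ i, viewDensity (r i) (inner ℝ (x i) (cubeVertex δ u τ)) (z i))
      (∏ i, viewDensity (r i) (inner ℝ (x i) (cubeVertex δ u (flipAt j τ))) (z i)))
      ∂(Measure.pi fun i => R i false) := fun τ j => by
    refine le_trans (ENNReal.ofReal_le_ofReal ?_)
      (half_sub_le_lintegral_min_prod_viewDensity hr0 hri hr1 hε hrb _ _)
    -- With `hle` and `hδ` the affinity loss is at most `κ * 4δ² * n ≤ 1/4`, leaving `1/2 - 1/4`.
    have hs : ∑ i, (inner ℝ (x i) (cubeVertex δ u τ) -
        inner ℝ (x i) (cubeVertex δ u (flipAt j τ))) ^ 2 =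
        4 * δ ^ 2 * ∑ i, (inner ℝ (x i) (u j)) ^ 2 := by
      rw [Finset.mul_sum]
      refine Finset.sum_congr rfl fun i _ => ?_
      rw [← inner_sub_right, cubeVertex_sub_flipAt, inner_smul_right, mul_pow, mul_pow, mul_pow,
        boolSign_sq]
      ring
    have hle := sum_inner_sq_le_of_norm_covEmbedding_eq_one hlam.le hn (hu.1 j)
    have hκ : 0 ≤ min 1 ((Real.exp ε - 1) ^ 2) := le_min zero_le_one (sq_nonneg _)
    rw [hs]
    have := mul_le_mul_of_nonneg_left hle (mul_nonneg hκ (sq_nonneg δ))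
    linarith
  obtain ⟨τ, hτ⟩ := assouad_lower_bound (Measure.pi fun i => R i false) est hf hg (δ := δ) hc
  refine ⟨τ, ?_⟩
  rw [semiNormRisk_eq_lintegral_prod_viewDensity lam x R est _ hrm hr0 hri hr]
  refine le_trans (le_of_eq (by congr 1; ring)) (hτ.trans ?_)
  gcongr with z t
  rw [← ENNReal.ofReal_sum_of_nonneg fun j _ => sq_nonneg _]
  exact ENNReal.ofReal_le_ofReal (sum_inner_sub_sq_le_matrixNorm_sq hlam.le δ hu τ t)

theorem mainTheorem2 :
    ∃ c : ℝ, 0 < c ∧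
      ∀ (d : ℕ) (B lam ε : ℝ), 2 ≤ d → 0 < B → 0 < lam → 0 < ε →
        ∃ N : ℕ, ∀ n : ℕ, N ≤ n →
          ∀ (x : Fin n → EuclideanSpace ℝ (Fin d))
            (Z : Type*) [MeasurableSpace Z]
            (R : Fin n → Kernel Bool Z) [∀ i, IsMarkovKernel (R i)]
            (est : Kernel (Fin n → Z) (EuclideanSpace ℝ (Fin d))) [IsMarkovKernel est],
            (∀ i, IsLabelDP ε (R i)) →
              ∃ θ ∈ paramSet d B,
                ENNReal.ofReal
                    (c * ((d : ℝ) / n + (d : ℝ) / ((Real.exp ε - 1) ^ 2 * n))) ≤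
                  semiNormRisk lam x R est θ := by
  -- `256 = 4 * 16 * 2 * 2`: Assouad's `1/4`, the `1/16` in `δ²`, `m ≥ d/2`, and `hκinv`.
  refine ⟨1 / 256, by norm_num, fun d B lam ε hd hB hlam hε => ?_⟩
  have hE : 0 < (Real.exp ε - 1) ^ 2 := by
    have := Real.add_one_le_exp ε
    exact pow_pos (by linarith) 2
  set κ := min 1 ((Real.exp ε - 1) ^ 2) with hκdef
  have hκ : 0 < κ := lt_min one_pos hE
  -- The ceiling forces `mδ² ≤ λB²`, so the vertices stay in the ball; the `+ 1` forces `n > 0`.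
  refine ⟨⌈d / (16 * κ * lam * B ^ 2)⌉₊ + 1, fun n hn x Z _ R _ est _ hR => ?_⟩
  have hn0 : 0 < n := by omega
  have hn0' : (0 : ℝ) < n := by exact_mod_cast hn0
  have hnB : (d : ℝ) ≤ n * (16 * κ * lam * B ^ 2) := by
    rw [← div_le_iff₀ (by positivity)]
    exact (Nat.le_ceil _).trans (by exact_mod_cast (Nat.le_succ _).trans hn)
  have hbasis := exists_orthonormal_covEmbedding hlam x
  have hmd : (Module.finrank ℝ (sumZero d) : ℝ) ≤ d := by
    have := Submodule.finrank_le (sumZero d)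
    rw [finrank_euclideanSpace, Fintype.card_fin] at this
    exact_mod_cast this
  have hdm : (d : ℝ) ≤ 2 * Module.finrank ℝ (sumZero d) := by
    have := le_finrank_sumZero d
    exact_mod_cast (by omega : d ≤ 2 * Module.finrank ℝ (sumZero d))
  generalize Module.finrank ℝ (sumZero d) = m at hbasis hmd hdm
  obtain ⟨u, hu0, hu⟩ := hbasis
  have hδ : √(1 / (16 * κ * n)) ^ 2 = 1 / (16 * κ * n) := Real.sq_sqrt (by positivity)
  obtain ⟨τ, hτ⟩ := exists_le_semiNormRisk_of_orthonormal hlam hε hn0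
    (δ := √(1 / (16 * κ * n))) (by rw [hδ, ← hκdef]; apply le_of_eq; field_simp) x R est hR hu
  refine ⟨_, ⟨cubeVertex_mem_sumZero _ hu0 τ, ?_⟩, le_trans (ENNReal.ofReal_le_ofReal ?_) hτ⟩
  · have h1 := norm_covEmbedding_cubeVertex_sq (√(1 / (16 * κ * n))) hu τ
    have h2 := norm_covEmbedding_sq hlam.le x (cubeVertex (√(1 / (16 * κ * n))) u τ)
    have h3 : 0 ≤ (n : ℝ)⁻¹ * ∑ i, (inner ℝ (x i) (cubeVertex (√(1 / (16 * κ * n))) u τ)) ^ 2 :=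
      mul_nonneg (by positivity) (Finset.sum_nonneg fun i _ => sq_nonneg _)
    have h4 : (m : ℝ) * (1 / (16 * κ * n)) ≤ lam * B ^ 2 := by
      rw [mul_one_div, div_le_iff₀ (by positivity)]
      linarith
    rw [hδ] at h1
    have h5 : lam * ‖cubeVertex (√(1 / (16 * κ * n))) u τ‖ ^ 2 ≤ lam * B ^ 2 := by linarith
    exact le_of_sq_le_sq (le_of_mul_le_mul_left h5 hlam) hB.le
  -- A sum is at most twice its larger term, which here is `1/κ`.
  · have hκinv : 1 + 1 / (Real.exp ε - 1) ^ 2 ≤ 2 / κ := by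
      rcases min_choice 1 ((Real.exp ε - 1) ^ 2) with h | h
      · have h1 := min_eq_left_iff.1 h
        rw [hκdef, h]
        have : 1 / (Real.exp ε - 1) ^ 2 ≤ 1 := (div_le_one hE).2 h1
        linarith
      · have h1 := min_eq_right_iff.1 h
        rw [hκdef, h]
        have : 1 ≤ 1 / (Real.exp ε - 1) ^ 2 := (one_le_div hE).2 h1
        have h2 : 2 / (Real.exp ε - 1) ^ 2 = 1 / (Real.exp ε - 1) ^ 2 + 1 / (Real.exp ε - 1) ^ 2 := by
          ring
        linarith
    rw [hδ]
    calc 1 / 256 * ((d : ℝ) / n + d / ((Real.exp ε - 1) ^ 2 * n))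
        = 1 / 256 * (d / n) * (1 + 1 / (Real.exp ε - 1) ^ 2) := by field_simp
      _ ≤ 1 / 256 * ((2 * m) / n) * (2 / κ) := by gcongr
      _ = m * (1 / (16 * κ * n)) / 4 := by field_simp; ring
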